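/- Fix $d\in\mathbb N$. Let $\mathcal M=C_b(\mathbb R^d;\mathbb R^d)'$ be the space of 1-currents, i.e. the topological dual of the bounded continuous vector fields with the uniform norm, with dual norm $|\xi|_{\mathcal M}=\sup_{\|\theta\|_\infty\le 1}|\xi(\theta)|$. Put $\|\xi\|=\sup\{\xi(\theta):\|\theta\|_\infty+\mathrm{Lip}(\theta)\le 1\}$ and write $\mathcal M_w$ for $\mathcal M$ with the topology of $\|\cdot\|$. Write $\|f\|_{C^2_b}=\|f\|_\infty+\|Df\|_\infty+\|D^2f\|_\infty$. Let $B:\mathcal M_w\to C^2_b(\mathbb R^d,\mathbb R^d)$ be a continuous map and $C_B$ a constant such that for all $\xi,\xi'\in\mathcal M$ $$\|B(\xi)\|_{C^2_b}\le C_B(\|\xi\|+1),\qquad \|B(\xi)-B(\xi')\|_\infty\le C_B\|\xi-\xi'\|,\qquad \|DB(\xi)-DB(\xi')\|_\infty\le C_B\|\xi-\xi'\|.$$ For $\xi\in C([0,T];\mathcal M_w)$ let $\varphi^{t,B(\xi)}(x)$, $t\in[0,T]$, be the flow of the equation $\dot x_t=B(\xi_t)(x_t)$, $x_0=x$. For a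 $C^1$ map $\varphi:\mathbb R^d\to\mathbb R^d$ with bounded derivative and $\xi\in\mathcal M$, let $\varphi_\sharp\xi\in\mathcal M$ be defined by $(\varphi_\sharp\xi)(\theta)=\xi(\varphi_\sharp\theta)$, where $(\varphi_\sharp\theta)(x)=D\varphi(x)^T\theta(\varphi(x))$. **Theorem.** For every $\xi_0\in\mathcal M$ there is $T_R>0$, depending only on $|\xi_0|_{\mathcal M}$ (and on $d$ and the constant $C_B$), such that the flow equation $$\xi_t=\varphi^{t,B(\xi)}_\sharp\xi_0,\qquad t\in[0,T_R],$$ has a unique solution $\xi$ in $C([0,T_R];\mathcal M_w)$. Moreover, the assumptions on the drift hold (for some $C_B$) for $B(\xi)=K*\xi$, $(K*\xi)_i(x)=\xi(K_{i\cdot}(x-\cdot))$, whenever $K:\mathbb R^d\to\mathbb R^{d\times d}$ is of class $C^3$, bounded with all its derivatives of order up to $3$, with $K$, $DK$, $D^2K$ uniformly continuous. -/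

import Mathlib

open Set Filter Topology
open scoped BoundedContinuousFunction NNReal

noncomputable section

namespace CurrentFlow

/-- Euclidean space `ℝ^d`. -/
abbrev Vec (d : ℕ) := EuclideanSpace ℝ (Fin d)

/-! All notions up to the flow equation are written for a real Hilbert space `E`; they are used for
`E = Vec d`. -/

/-- The space `C_b(E; E)` of bounded continuous vector fields with the uniform norm. -/
abbrev Field (E : Type*) [NormedAddCommGroup E] := E →ᵇ E

/-- The topological dual of a real normed space, with the operator norm. -/
abbrev TopDual (V : Type*) [NormedAddCommGroup V] [NormedSpace ℝ V] := V →L[ℝ] ℝ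

/-- The space `M = C_b(E; E)'` of 1-currents; its norm `‖ξ‖` in Mathlib is the strong
(dual) norm `|ξ|_M`. -/
abbrev Current (E : Type*) [NormedAddCommGroup E] [InnerProductSpace ℝ E] :=
  TopDual (Field E)

variable {E : Type*} [NormedAddCommGroup E] [InnerProductSpace ℝ E]

/-! ### The weak norm -/

/-- The values on which the weak norm is a supremum: `ξ(θ)` with `‖θ‖_∞ + Lip(θ) ≤ 1`. -/
def weakValues (ξ : Current E) : Set ℝ :=
  {r | ∃ (θ : Field E) (L : ℝ≥0), LipschitzWith L θ ∧ ‖θ‖ + (L : ℝ) ≤ 1 ∧ r = ξ θ}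

/-- The weak (Lipschitz-dual) norm `sup {ξ(θ) : ‖θ‖_∞ + Lip(θ) ≤ 1}` of a current. -/
def weakNorm (ξ : Current E) : ℝ := sSup (weakValues ξ)

theorem le_norm_of_mem_weakValues {ξ : Current E} {r : ℝ} (hr : r ∈ weakValues ξ) :
    r ≤ ‖ξ‖ := by
  obtain ⟨θ, L, -, h, rfl⟩ := hr
  have h1 : ‖θ‖ ≤ 1 := by
    have := L.coe_nonneg
    linarith
  calc ξ θ ≤ ‖ξ θ‖ := Real.le_norm_self _
    _ ≤ ‖ξ‖ * ‖θ‖ := ξ.le_opNorm θ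
    _ ≤ ‖ξ‖ * 1 := by gcongr
    _ = ‖ξ‖ := mul_one _

/-- The supremum in the weak norm is a genuine one. -/
theorem isLUB_weakNorm (ξ : Current E) : IsLUB (weakValues ξ) (weakNorm ξ) :=
  isLUB_csSup ⟨0, 0, 0, LipschitzWith.const 0, by simp, by simp⟩
    ⟨‖ξ‖, fun _ hr => le_norm_of_mem_weakValues hr⟩

theorem weakNorm_le_norm (ξ : Current E) : weakNorm ξ ≤ ‖ξ‖ :=
  (isLUB_weakNorm ξ).2 fun _ hr => le_norm_of_mem_weakValues hr

/-- `ξ ∈ C([0,T]; M_w)`: the restriction of `ξ` to `[0,T]` is continuous for the weak norm. -/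
def WeaklyContinuousOn (T : ℝ) (ξ : ℝ → Current E) : Prop :=
  ∀ s ∈ Icc 0 T, Tendsto (fun t => weakNorm (ξ t - ξ s)) (𝓝[Icc 0 T] s) (𝓝 0)

/-! ### The spaces `C_b^k` and `UC_b^3` -/

section Cb

variable {F : Type*} [NormedAddCommGroup F] [NormedSpace ℝ F]

/-- `f ∈ C_b^k(E, F)`: of class `C^k` and bounded with all derivatives of order up to `k`. -/
def IsCb (k : ℕ) (f : E → F) : Prop :=
  ContDiff ℝ k f ∧ ∀ j ≤ k, ∃ c : ℝ, ∀ x, ‖iteratedFDeriv ℝ j f x‖ ≤ c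

/-- `f ∈ UC_b^3(E, F)`: `f ∈ C_b^3` and `f`, `Df`, `D²f` are uniformly continuous. -/
def IsUCb3 (f : E → F) : Prop :=
  IsCb 3 f ∧ ∀ j ≤ 2, UniformContinuous (iteratedFDeriv ℝ j f)

/-- The supremum norm of a function (used for bounded functions only). -/
def supNorm (f : E → F) : ℝ := ⨆ x, ‖f x‖

/-- The `C_b^k` norm `∑_{j ≤ k} ‖D^j f‖_∞` (used on `C_b^k` only). -/
def cbNorm (k : ℕ) (f : E → F) : ℝ :=
  ∑ j ∈ Finset.range (k + 1), supNorm (iteratedFDeriv ℝ j f)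

end Cb

/-! ### Assumptions on the drift -/

/-- The drift `B` is a continuous map `M_w → C_b^2(E, E)` which satisfies the growth bound and
the two Lipschitz bounds with constant `C`. -/
structure IsDrift (C : ℝ) (B : Current E → E → E) : Prop where
  mem_cb : ∀ ξ, IsCb 2 (B ξ)
  continuous : ∀ ξ, ∀ ε > 0, ∃ δ > 0, ∀ ξ', weakNorm (ξ' - ξ) < δ →
    cbNorm 2 (fun x => B ξ' x - B ξ x) < ε
  growth : ∀ ξ, cbNorm 2 (B ξ) ≤ C * (weakNorm ξ + 1)
  lipschitz : ∀ ξ ξ', supNorm (fun x => B ξ x - B ξ' x) ≤ C * weakNorm (ξ - ξ')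
  lipschitz_deriv : ∀ ξ ξ',
    supNorm (fun x => fderiv ℝ (B ξ) x - fderiv ℝ (B ξ') x) ≤ C * weakNorm (ξ - ξ')

/-! ### Push-forward -/

/-- The maps along which fields and currents are pushed forward: `φ` is of class `C¹` and `Dφ` is
bounded. -/
structure IsPushable (φ : E → E) : Prop where
  contDiff : ContDiff ℝ 1 φ
  bounded : ∃ c : ℝ, ∀ x, ‖fderiv ℝ φ x‖ ≤ c

variable [CompleteSpace E]

theorem IsPushable.norm_le {φ : E → E} (hφ : IsPushable φ) (θ : Field E) (x : E) :
    ‖ContinuousLinearMap.adjoint (fderiv ℝ φ x) (θ (φ x))‖ ≤ hφ.bounded.choose * ‖θ‖ := by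
  have h := hφ.bounded.choose_spec x
  have h0 : 0 ≤ hφ.bounded.choose := (norm_nonneg _).trans h
  calc _ ≤ ‖ContinuousLinearMap.adjoint (fderiv ℝ φ x)‖ * ‖θ (φ x)‖ :=
        ContinuousLinearMap.le_opNorm _ _
    _ ≤ hφ.bounded.choose * ‖θ‖ := by
        rw [LinearIsometryEquiv.norm_map]
        exact mul_le_mul h (θ.norm_coe_le_norm _) (norm_nonneg _) h0

/-- The vector field `(φ_♯ θ)(x) = Dφ(x)ᵀ θ(φ(x))`. -/
def pushField (φ : E → E) (hφ : IsPushable φ) (θ : Field E) : Field E :=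
  BoundedContinuousFunction.ofNormedAddCommGroup
    (fun x => ContinuousLinearMap.adjoint (fderiv ℝ φ x) (θ (φ x)))
    (((ContinuousLinearMap.adjoint (𝕜 := ℝ) (E := E) (F := E)).continuous.comp
        (hφ.contDiff.continuous_fderiv one_ne_zero)).clm_apply
      (θ.continuous.comp hφ.contDiff.continuous))
    (hφ.bounded.choose * ‖θ‖) (hφ.norm_le θ)

@[simp]
theorem pushField_apply (φ : E → E) (hφ : IsPushable φ) (θ : Field E) (x : E) :
    pushField φ hφ θ x = ContinuousLinearMap.adjoint (fderiv ℝ φ x) (θ (φ x)) := rfl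

/-- The push-forward of fields as a bounded linear map of `C_b(E; E)`. -/
def pushFieldL (φ : E → E) (hφ : IsPushable φ) : Field E →L[ℝ] Field E :=
  LinearMap.mkContinuous
    { toFun := pushField φ hφ
      map_add' := fun θ η => by ext1 x; simp
      map_smul' := fun c θ => by ext1 x; simp }
    hφ.bounded.choose
    (fun θ => BoundedContinuousFunction.norm_ofNormedAddCommGroup_le _
      (mul_nonneg ((norm_nonneg _).trans (hφ.bounded.choose_spec 0)) (norm_nonneg θ))
      (hφ.norm_le θ))

/-- The push-forward `φ_♯ ξ` of a current, `(φ_♯ ξ)(θ) = ξ(φ_♯ θ)`. -/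
def push (φ : E → E) (hφ : IsPushable φ) (ξ : Current E) : Current E :=
  ξ.comp (pushFieldL φ hφ)

@[simp]
theorem push_apply (φ : E → E) (hφ : IsPushable φ) (ξ : Current E) (θ : Field E) :
    push φ hφ ξ θ = ξ (pushField φ hφ θ) := rfl

/-! ### The flow equation -/

/-- `φ t = φ^{t,b}` for `t ∈ [0,T]` is the flow of the time-dependent vector field `b`:
`t ↦ φ t x` solves `X' = b(t, X)` on `[0,T]` with `X_0 = x`. -/
def IsFlow (T : ℝ) (b : ℝ → E → E) (φ : ℝ → E → E) : Prop :=
  ∀ x, φ 0 x = x ∧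
    ∀ t ∈ Icc 0 T, HasDerivWithinAt (fun s => φ s x) (b t (φ t x)) (Icc 0 T) t

/-- `ξ` is a solution in `C([0,T]; M_w)` of the flow equation `ξ_t = φ^{t,B(ξ)}_♯ ξ₀`,
`t ∈ [0,T]`. Only the values of `ξ` on `[0,T]` matter. -/
structure IsSolution (B : Current E → E → E) (ξ₀ : Current E) (T : ℝ)
    (ξ : ℝ → Current E) : Prop where
  continuous : WeaklyContinuousOn T ξ
  flow_eq : ∃ φ : ℝ → E → E, IsFlow T (fun t => B (ξ t)) φ ∧
    ∀ t ∈ Icc 0 T, ∃ hφ : IsPushable (φ t), ξ t = push (φ t) hφ ξ₀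

/-! ### The convolution `K ∗ ξ` -/

variable {d : ℕ}

/-- `K ∈ UC_b^3(ℝ^d, ℝ^{d×d})`, stated entry by entry. -/
def IsKernel (K : Vec d → Matrix (Fin d) (Fin d) ℝ) : Prop :=
  ∀ i j, IsUCb3 (fun x => K x i j)

theorem IsKernel.continuous_entry {K : Vec d → Matrix (Fin d) (Fin d) ℝ} (hK : IsKernel K)
    (i j : Fin d) : Continuous (fun x => K x i j) :=
  (hK i j).1.1.continuous

theorem IsKernel.exists_bound_row {K : Vec d → Matrix (Fin d) (Fin d) ℝ} (hK : IsKernel K)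
    (i : Fin d) : ∃ c : ℝ, ∀ x, ‖(WithLp.toLp 2 (K x i) : Vec d)‖ ≤ c := by
  have h : ∀ j, ∃ c : ℝ, ∀ x, ‖K x i j‖ ≤ c := fun j => by
    obtain ⟨c, hc⟩ := (hK i j).1.2 0 (Nat.zero_le _)
    exact ⟨c, fun x => by simpa using hc x⟩
  choose c hc using h
  refine ⟨√(∑ j, c j ^ 2), fun x => ?_⟩
  rw [EuclideanSpace.norm_eq]
  refine Real.sqrt_le_sqrt (Finset.sum_le_sum fun j _ => ?_)
  exact pow_le_pow_left₀ (norm_nonneg _) (hc j x) 2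

/-- The vector field `y ↦ K_{i·}(x - y)`. -/
def rowField (K : Vec d → Matrix (Fin d) (Fin d) ℝ) (hK : IsKernel K) (i : Fin d) (x : Vec d) :
    Field (Vec d) :=
  BoundedContinuousFunction.ofNormedAddCommGroup
    (fun y => (WithLp.toLp 2 (K (x - y) i) : Vec d))
    ((PiLp.continuous_toLp 2 _).comp (continuous_pi fun j =>
      (hK.continuous_entry i j).comp (continuous_const.sub continuous_id)))
    (hK.exists_bound_row i).choose
    (fun y => (hK.exists_bound_row i).choose_spec (x - y))

/-- The vector field `K ∗ ξ` with components `(K ∗ ξ)_i(x) = ξ(K_{i·}(x - ·))`. -/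
def conv (K : Vec d → Matrix (Fin d) (Fin d) ℝ) (hK : IsKernel K) (ξ : Current (Vec d)) :
    Vec d → Vec d :=
  fun x => WithLp.toLp 2 (fun i => ξ (rowField K hK i x))

end CurrentFlow

end

/-!
The flow equation is an ordinary differential equation in a Banach space. Write a flow as
`φ_t = id + u_t`. Since the test fields of the weak norm are Lipschitz, the push-forward
`u ↦ (id + u)_♯ ξ₀` is locally Lipschitz from `C_b^1(E, E)` to the weak norm
(`C1b.weakNorm_transport_sub_le`), and the assumptions on the drift then make the vector field
`u ↦ B((id + u)_♯ ξ₀) ∘ (id + u)` on `C_b^1(E, E)` Lipschitz on bounded sets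
(`norm_velocity_sub_le`), with constants that depend only on the radius, on the constant of the
drift and on the strong norm of `ξ₀`. The space `C_b^1(E, E)` is complete, so the Picard–Lindelöf
theorem gives an integral curve issuing from `0` on a time interval controlled by these constants,
and its push-forwards of `ξ₀` solve the flow equation (`IsCurve.isSolution`). Working with the maps
rather than with the currents avoids any completeness of the space of currents, on which the weak
norm is only a seminorm.

For uniqueness, the flow `φ` of an arbitrary solution is shown to be such an integral curve
(`IsSolution.exists_isCurve`). Grönwall's inequality bounds the Lipschitz constant of `φ_t - φ_s`
in space by a multiple of `|t - s|`, so that `t ↦ φ_t - id` is continuous in `C_b^1`; it satisfies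
the equation in integrated form because it does so at each point. Two integral curves with the same
initial value coincide, hence so do the flows, and the currents are equal, not merely at weak
distance zero.

For `B(ξ) = K ∗ ξ`, the translation `x ↦ k(x - ·)` of `k ∈ C_b^3` is twice continuously
differentiable with values in the bounded functions, and the derivatives of `K ∗ ξ` are the values
of `ξ` on the translates of those of `K`. These translates are bounded and Lipschitz up to order
two, so `‖K ∗ ξ‖_{C_b^2}` is at most a multiple of the weak norm of `ξ`
(`exists_hasCbBound_conv`), and by linearity in `ξ` this contains all the assumptions on the drift.
-/

noncomputable section

namespace CurrentFlow

/-! ### The weak norm and the `C_b^k` norm -/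

section SupNorm

variable {E F : Type*} [NormedAddCommGroup F]

theorem norm_le_supNorm {f : E → F} {c : ℝ} (hc : ∀ x, ‖f x‖ ≤ c) (x : E) : ‖f x‖ ≤ supNorm f :=
  le_ciSup (f := fun x => ‖f x‖) ⟨c, by rintro _ ⟨y, rfl⟩; exact hc y⟩ x

theorem supNorm_le [Nonempty E] {f : E → F} {c : ℝ} (hc : ∀ x, ‖f x‖ ≤ c) : supNorm f ≤ c :=
  ciSup_le hc

theorem supNorm_nonneg (f : E → F) : 0 ≤ supNorm f := Real.iSup_nonneg fun _ => norm_nonneg _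

end SupNorm

section Norms

variable {E : Type*} [NormedAddCommGroup E] [InnerProductSpace ℝ E]

theorem weakNorm_nonneg (ξ : Current E) : 0 ≤ weakNorm ξ :=
  (isLUB_weakNorm ξ).1 ⟨0, 0, LipschitzWith.const 0, by simp, by simp⟩

/-- Duality between the weak norm and the norm `‖θ‖_∞ + Lip(θ)`. -/
theorem apply_le_weakNorm_mul (ξ : Current E) {θ : Field E} {s : ℝ} {L : ℝ≥0} (hs : ‖θ‖ ≤ s)
    (hθ : LipschitzWith L θ) : ξ θ ≤ weakNorm ξ * (s + L) := by
  have h0 : 0 ≤ s + L := add_nonneg ((norm_nonneg _).trans hs) L.coe_nonneg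
  refine le_of_forall_pos_le_add fun ε hε => ?_
  set w := weakNorm ξ with hw
  have hw0 : 0 ≤ w := weakNorm_nonneg ξ
  -- dividing by `s + L + δ` rather than by `s + L` covers the case `s + L = 0`
  set δ : ℝ := ε / (w + 1)
  have hδ : 0 < δ := by positivity
  set a : ℝ := (s + L + δ)⁻¹
  have hpos : 0 < s + L + δ := by positivity
  have ha : 0 < a := inv_pos.2 hpos
  have hmem : ξ (a • θ) ∈ weakValues ξ := by
    refine ⟨a • θ, a.toNNReal * L, ?_, ?_, rfl⟩
    · refine LipschitzWith.of_dist_le_mul fun x y => ?_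
      have := hθ.dist_le_mul x y
      simp only [BoundedContinuousFunction.coe_smul, dist_smul₀, NNReal.coe_mul,
        Real.coe_toNNReal a ha.le, Real.norm_of_nonneg ha.le, mul_assoc]
      exact mul_le_mul_of_nonneg_left this ha.le
    · rw [norm_smul, NNReal.coe_mul, Real.coe_toNNReal a ha.le, Real.norm_of_nonneg ha.le,
        ← mul_add, inv_mul_le_iff₀ hpos]
      linarith
  have h1 := (isLUB_weakNorm ξ).1 hmem
  rw [map_smul, smul_eq_mul, inv_mul_le_iff₀ hpos, ← hw] at h1
  have h2 : δ * w ≤ ε := by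
    rw [div_mul_eq_mul_div, div_le_iff₀ (by positivity)]
    nlinarith
  nlinarith

theorem abs_apply_le_weakNorm_mul (ξ : Current E) {θ : Field E} {s : ℝ} {L : ℝ≥0} (hs : ‖θ‖ ≤ s)
    (hθ : LipschitzWith L θ) : |ξ θ| ≤ weakNorm ξ * (s + L) := by
  refine abs_le.2 ⟨?_, apply_le_weakNorm_mul ξ hs hθ⟩
  have := apply_le_weakNorm_mul ξ (θ := -θ) (norm_neg θ).le hθ.neg
  rw [map_neg] at this
  have h2 := mul_le_mul_of_nonneg_left (add_le_add_left hs (L : ℝ)) (weakNorm_nonneg ξ)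
  linarith

theorem weakNorm_le {ξ : Current E} {c : ℝ}
    (h : ∀ (θ : Field E) (L : ℝ≥0), LipschitzWith L θ → ‖θ‖ + (L : ℝ) ≤ 1 → ξ θ ≤ c) :
    weakNorm ξ ≤ c :=
  (isLUB_weakNorm ξ).2 fun _ ⟨θ, L, hL, h1, hr⟩ => hr ▸ h θ L hL h1

theorem weakNorm_le_add_sub (ξ η : Current E) : weakNorm ξ ≤ weakNorm η + weakNorm (ξ - η) := by
  refine weakNorm_le fun θ L hL h1 => ?_
  have h2 := (isLUB_weakNorm η).1 ⟨θ, L, hL, h1, rfl⟩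
  have h3 := (isLUB_weakNorm (ξ - η)).1 ⟨θ, L, hL, h1, rfl⟩
  rw [sub_apply] at h3
  linarith

theorem weakNorm_sub_comm (ξ η : Current E) : weakNorm (ξ - η) = weakNorm (η - ξ) := by
  have h : ∀ ξ η : Current E, weakNorm (ξ - η) ≤ weakNorm (η - ξ) := fun ξ η =>
    weakNorm_le fun θ L hL h1 => by
      have := (isLUB_weakNorm (η - ξ)).1 ⟨-θ, L, hL.neg, by rwa [norm_neg], rfl⟩
      rw [map_neg] at this
      simp only [sub_apply] at this ⊢
      linarith
  exact le_antisymm (h _ _) (h _ _)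

theorem WeaklyContinuousOn.continuousOn_weakNorm {T : ℝ} {ξ : ℝ → Current E}
    (h : WeaklyContinuousOn T ξ) : ContinuousOn (fun t => weakNorm (ξ t)) (Icc 0 T) := by
  intro s hs
  rw [ContinuousWithinAt, tendsto_iff_dist_tendsto_zero]
  refine squeeze_zero (fun _ => dist_nonneg) (fun t => ?_) (h s hs)
  rw [Real.dist_eq, abs_le]
  have h1 := weakNorm_le_add_sub (ξ t) (ξ s)
  have h2 := weakNorm_le_add_sub (ξ s) (ξ t)
  rw [weakNorm_sub_comm] at h2
  constructor <;> linarith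

variable {F : Type*} [NormedAddCommGroup F] [NormedSpace ℝ F]

theorem cbNorm_nonneg (k : ℕ) (f : E → F) : 0 ≤ cbNorm k f :=
  Finset.sum_nonneg fun _ _ => supNorm_nonneg _

theorem IsCb.norm_iteratedFDeriv_le {k : ℕ} {f : E → F} (hf : IsCb k f) {j : ℕ} (hj : j ≤ k)
    (x : E) : ‖iteratedFDeriv ℝ j f x‖ ≤ cbNorm k f := by
  obtain ⟨c, hc⟩ := hf.2 j hj
  exact (norm_le_supNorm hc x).trans
    (Finset.single_le_sum (f := fun j => supNorm (iteratedFDeriv ℝ j f))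
      (fun _ _ => supNorm_nonneg _) (Finset.mem_range.2 (by omega)))

theorem norm_iteratedFDeriv_two (f : E → F) (x : E) :
    ‖iteratedFDeriv ℝ 2 f x‖ = ‖fderiv ℝ (fderiv ℝ f) x‖ := by
  rw [← norm_iteratedFDeriv_fderiv, norm_iteratedFDeriv_one]

theorem IsCb.norm_le {k : ℕ} {f : E → F} (hf : IsCb k f) (x : E) : ‖f x‖ ≤ cbNorm k f := by
  simpa using hf.norm_iteratedFDeriv_le (Nat.zero_le k) x

theorem IsCb.norm_fderiv_le {k : ℕ} {f : E → F} (hf : IsCb k f) (hk : 1 ≤ k) (x : E) :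
    ‖fderiv ℝ f x‖ ≤ cbNorm k f := by
  simpa [norm_iteratedFDeriv_one] using hf.norm_iteratedFDeriv_le hk x

theorem norm_image_sub_le_of_norm_fderiv_le {f : E → F} {c : ℝ} (hf : Differentiable ℝ f)
    (hc : ∀ x, ‖fderiv ℝ f x‖ ≤ c) (x y : E) : ‖f x - f y‖ ≤ c * ‖x - y‖ :=
  convex_univ.norm_image_sub_le_of_norm_fderiv_le (fun z _ => hf z) (fun z _ => hc z)
    (mem_univ y) (mem_univ x)

theorem IsCb.norm_sub_le {k : ℕ} {f : E → F} (hf : IsCb k f) (hk : 1 ≤ k) (x y : E) :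
    ‖f x - f y‖ ≤ cbNorm k f * ‖x - y‖ :=
  norm_image_sub_le_of_norm_fderiv_le (hf.1.differentiable (by exact_mod_cast (by omega)))
    (hf.norm_fderiv_le hk) x y

theorem IsCb.norm_fderiv_sub_le {f : E → F} (hf : IsCb 2 f) (x y : E) :
    ‖fderiv ℝ f x - fderiv ℝ f y‖ ≤ cbNorm 2 f * ‖x - y‖ := by
  refine norm_image_sub_le_of_norm_fderiv_le ?_ (fun z => ?_) x y
  · exact (hf.1.fderiv_right (m := 1) (by norm_num)).differentiable one_ne_zero
  · rw [← norm_iteratedFDeriv_two]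
    exact hf.norm_iteratedFDeriv_le le_rfl z

end Norms

/-! ### Pointwise bounds on the drift -/

section Drift

variable {E : Type*} [NormedAddCommGroup E] [InnerProductSpace ℝ E]
  {C : ℝ} {B : Current E → E → E}

theorem IsDrift.const_nonneg (hB : IsDrift C B) : 0 ≤ C := by
  have h := (cbNorm_nonneg 2 (B 0)).trans (hB.growth 0)
  have h0 := weakNorm_nonneg (0 : Current E)
  exact nonneg_of_mul_nonneg_left h (by positivity)

theorem IsDrift.norm_sub_le (hB : IsDrift C B) (ξ η : Current E) (x : E) :
    ‖B ξ x - B η x‖ ≤ C * weakNorm (ξ - η) :=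
  (norm_le_supNorm (f := fun x => B ξ x - B η x) (fun y => (_root_.norm_sub_le _ _).trans
    (add_le_add ((hB.mem_cb ξ).norm_le y) ((hB.mem_cb η).norm_le y))) x).trans (hB.lipschitz ξ η)

theorem IsDrift.norm_fderiv_sub_le (hB : IsDrift C B) (ξ η : Current E) (x : E) :
    ‖fderiv ℝ (B ξ) x - fderiv ℝ (B η) x‖ ≤ C * weakNorm (ξ - η) :=
  (norm_le_supNorm (f := fun x => fderiv ℝ (B ξ) x - fderiv ℝ (B η) x)
    (fun y => (_root_.norm_sub_le _ _).trans
      (add_le_add ((hB.mem_cb ξ).norm_fderiv_le one_le_two y)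
        ((hB.mem_cb η).norm_fderiv_le one_le_two y))) x).trans (hB.lipschitz_deriv ξ η)

end Drift

/-! ### The Banach space `C_b^1(E, E)` -/

section C1b

variable {E : Type*} [NormedAddCommGroup E] [InnerProductSpace ℝ E]

/-- The space `C_b(α, V)` of bounded continuous maps into a normed space, with the topology of `V`
taken from its norm. -/
abbrev Bdd (α V : Type*) [TopologicalSpace α] [NormedAddCommGroup V] := α →ᵇ V

/-- The subspace of the functions `(u, Du)` in `C_b(E, E × L(E, E))`. -/
def c1bSubmodule (E : Type*) [NormedAddCommGroup E] [InnerProductSpace ℝ E] :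
    Submodule ℝ (Bdd E (E × (E →L[ℝ] E))) where
  carrier := {p | ∀ x, HasFDerivAt (fun y => (p y).1) (p x).2 x}
  add_mem' hp hq x := (hp x).add (hq x)
  zero_mem' x := hasFDerivAt_const 0 x
  smul_mem' c _ hp x := (hp x).const_smul c

theorem isClosed_c1bSubmodule : IsClosed (c1bSubmodule E : Set (Bdd E (E × (E →L[ℝ] E)))) := by
  refine isClosed_of_closure_subset fun p hp => ?_
  obtain ⟨q, hq, hlim⟩ := mem_closure_iff_seq_limit.1 hp
  have hlim' := BoundedContinuousFunction.tendsto_iff_tendstoUniformly.1 hlim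
  exact hasFDerivAt_of_tendstoUniformly (uniformContinuous_snd.comp_tendstoUniformly hlim') hq
    (fun x => (uniformContinuous_fst.comp_tendstoUniformly hlim').tendsto_at x)

/-- The space `C_b^1(E, E)`, encoded as the space of the functions `(u, Du)` inside
`C_b(E, E × L(E, E))`; the norm is `max ‖u‖_∞ ‖Du‖_∞`. -/
abbrev C1b (E : Type*) [NormedAddCommGroup E] [InnerProductSpace ℝ E] : Type _ :=
  c1bSubmodule E

instance [CompleteSpace E] : CompleteSpace (C1b E) := isClosed_c1bSubmodule.completeSpace_coe

namespace C1b

/-- The element of `C_b^1` given by a function and its bounded continuous derivative. -/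
def mk (f : E → E) (f' : E → E →L[ℝ] E) (hf : ∀ x, HasFDerivAt f (f' x) x) (hf' : Continuous f')
    (c : ℝ) (hc : ∀ x, ‖f x‖ ≤ c) (hc' : ∀ x, ‖f' x‖ ≤ c) : C1b E :=
  ⟨BoundedContinuousFunction.ofNormedAddCommGroup (fun x => (f x, f' x))
    ((continuous_iff_continuousAt.2 fun x => (hf x).continuousAt).prodMk hf') c
    fun x => max_le (hc x) (hc' x), hf⟩

/-- The function `u` underlying an element of `C_b^1`. -/
def val (p : C1b E) (x : E) : E := (p.1 x).1

/-- The derivative `Du` of an element `u` of `C_b^1`. -/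
def deriv (p : C1b E) (x : E) : E →L[ℝ] E := (p.1 x).2

theorem hasFDerivAt_val (p : C1b E) (x : E) : HasFDerivAt p.val (p.deriv x) x := p.2 x

theorem continuous_val (p : C1b E) : Continuous p.val := continuous_fst.comp p.1.continuous

theorem continuous_deriv (p : C1b E) : Continuous p.deriv := continuous_snd.comp p.1.continuous

theorem val_sub (p q : C1b E) (x : E) : (p - q).val x = p.val x - q.val x := rfl

theorem deriv_sub (p q : C1b E) (x : E) : (p - q).deriv x = p.deriv x - q.deriv x := rfl

theorem norm_le {p : C1b E} {c : ℝ} (h1 : ∀ x, ‖p.val x‖ ≤ c) (h2 : ∀ x, ‖p.deriv x‖ ≤ c) :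
    ‖p‖ ≤ c :=
  (BoundedContinuousFunction.norm_le ((norm_nonneg _).trans (h1 0))).2
    fun x => max_le (h1 x) (h2 x)

theorem norm_val_le (p : C1b E) (x : E) : ‖p.val x‖ ≤ ‖p‖ :=
  (le_max_left _ _).trans (p.1.norm_coe_le_norm x)

theorem norm_deriv_le (p : C1b E) (x : E) : ‖p.deriv x‖ ≤ ‖p‖ :=
  (le_max_right _ _).trans (p.1.norm_coe_le_norm x)

theorem ext_val {p q : C1b E} (h : ∀ x, p.val x = q.val x) : p = q := by
  refine Subtype.ext (BoundedContinuousFunction.ext fun x => Prod.ext (h x) ?_)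
  have h2 := p.hasFDerivAt_val x
  rw [funext h] at h2
  exact h2.unique (q.hasFDerivAt_val x)

/-- Evaluation at a point as a continuous linear map. -/
def eval (x : E) : C1b E →L[ℝ] E :=
  (ContinuousLinearMap.fst ℝ E (E →L[ℝ] E)).comp
    ((BoundedContinuousFunction.evalCLM ℝ x).comp (c1bSubmodule E).subtypeL)

/-- The map `id + u` of an element `u ∈ C_b^1`. -/
def toMap (p : C1b E) (x : E) : E := x + p.val x

/-- The derivative `id + Du` of `id + u`. -/
def jac (p : C1b E) (x : E) : E →L[ℝ] E := ContinuousLinearMap.id ℝ E + p.deriv x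

theorem hasFDerivAt_toMap (p : C1b E) (x : E) : HasFDerivAt p.toMap (p.jac x) x :=
  (hasFDerivAt_id x).add (p.hasFDerivAt_val x)

theorem fderiv_toMap (p : C1b E) (x : E) : fderiv ℝ p.toMap x = p.jac x :=
  (p.hasFDerivAt_toMap x).fderiv

theorem continuous_jac (p : C1b E) : Continuous p.jac := continuous_const.add p.continuous_deriv

theorem continuous_toMap (p : C1b E) : Continuous p.toMap := continuous_id.add p.continuous_val

theorem norm_jac_le (p : C1b E) (x : E) : ‖p.jac x‖ ≤ 1 + ‖p‖ :=
  (norm_add_le _ _).trans (add_le_add ContinuousLinearMap.norm_id_le (p.norm_deriv_le x))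

theorem norm_toMap_sub_le (p q : C1b E) (x : E) : ‖p.toMap x - q.toMap x‖ ≤ ‖p - q‖ := by
  simpa [toMap, val_sub] using (p - q).norm_val_le x

theorem norm_jac_sub_le (p q : C1b E) (x : E) : ‖p.jac x - q.jac x‖ ≤ ‖p - q‖ := by
  simpa [jac, deriv_sub] using (p - q).norm_deriv_le x

theorem isPushable (p : C1b E) : IsPushable p.toMap where
  contDiff := by
    rw [contDiff_one_iff_fderiv]
    refine ⟨fun x => (p.hasFDerivAt_toMap x).differentiableAt, ?_⟩
    rw [funext p.fderiv_toMap]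
    exact p.continuous_jac
  bounded := ⟨1 + ‖p‖, fun x => by rw [fderiv_toMap]; exact p.norm_jac_le x⟩

variable [CompleteSpace E]

/-- The current `(id + u)_♯ ξ₀`. -/
def transport (ξ₀ : Current E) (p : C1b E) : Current E := push p.toMap p.isPushable ξ₀

/-- The push-forward depends on the map only, not on the way it is presented. -/
theorem transport_eq_push (ξ₀ : Current E) (p : C1b E) {φ : E → E} (hφ : IsPushable φ)
    (h : p.toMap = φ) : transport ξ₀ p = push φ hφ ξ₀ := by
  subst h
  rfl

theorem weakNorm_transport_le (ξ₀ : Current E) (p : C1b E) :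
    weakNorm (transport ξ₀ p) ≤ ‖ξ₀‖ * (1 + ‖p‖) := by
  refine weakNorm_le fun θ L hL h1 => ?_
  have hθ : ‖θ‖ ≤ 1 := by linarith [L.coe_nonneg]
  rw [transport, push_apply]
  refine (Real.le_norm_self _).trans ((ξ₀.le_opNorm _).trans ?_)
  gcongr
  refine (BoundedContinuousFunction.norm_le (by positivity)).2 fun x => ?_
  rw [pushField_apply, fderiv_toMap]
  refine (ContinuousLinearMap.le_opNorm _ _).trans ?_
  rw [LinearIsometryEquiv.norm_map]
  calc ‖p.jac x‖ * ‖θ (p.toMap x)‖ ≤ (1 + ‖p‖) * 1 := by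
        gcongr
        exacts [p.norm_jac_le x, (θ.norm_coe_le_norm _).trans hθ]
    _ = 1 + ‖p‖ := mul_one _

/-- The push-forward is Lipschitz from `C_b^1` to the weak norm. Only one derivative of the map is
needed because the test fields are Lipschitz. -/
theorem weakNorm_transport_sub_le (ξ₀ : Current E) {p q : C1b E} {R : ℝ} (hq : ‖q‖ ≤ R) :
    weakNorm (transport ξ₀ p - transport ξ₀ q) ≤ ‖ξ₀‖ * (1 + R) * ‖p - q‖ := by
  have hR : 0 ≤ R := (norm_nonneg _).trans hq
  refine weakNorm_le fun θ L hL h1 => ?_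
  have hL0 := L.coe_nonneg
  rw [transport, transport, sub_apply, push_apply, push_apply, ← map_sub]
  refine (Real.le_norm_self _).trans ((ξ₀.le_opNorm _).trans ?_)
  rw [mul_assoc]
  gcongr
  refine (BoundedContinuousFunction.norm_le (by positivity)).2 fun x => ?_
  rw [BoundedContinuousFunction.sub_apply, pushField_apply, pushField_apply, fderiv_toMap,
    fderiv_toMap]
  have hsplit : ContinuousLinearMap.adjoint (p.jac x) (θ (p.toMap x)) -
      ContinuousLinearMap.adjoint (q.jac x) (θ (q.toMap x)) =
      ContinuousLinearMap.adjoint (p.jac x - q.jac x) (θ (p.toMap x)) +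
      ContinuousLinearMap.adjoint (q.jac x) (θ (p.toMap x) - θ (q.toMap x)) := by
    simp only [map_sub, sub_apply]
    abel
  have hA : ‖ContinuousLinearMap.adjoint (p.jac x - q.jac x) (θ (p.toMap x))‖ ≤
      ‖p - q‖ * ‖θ‖ := by
    refine (ContinuousLinearMap.le_opNorm _ _).trans ?_
    rw [LinearIsometryEquiv.norm_map]
    exact mul_le_mul (norm_jac_sub_le p q x) (θ.norm_coe_le_norm _) (norm_nonneg _)
      (norm_nonneg _)
  have hD : ‖ContinuousLinearMap.adjoint (q.jac x) (θ (p.toMap x) - θ (q.toMap x))‖ ≤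
      (1 + R) * (L * ‖p - q‖) := by
    refine (ContinuousLinearMap.le_opNorm _ _).trans ?_
    rw [LinearIsometryEquiv.norm_map]
    refine mul_le_mul ((q.norm_jac_le x).trans (by linarith)) ?_ (norm_nonneg _) (by positivity)
    refine (hL.norm_sub_le _ _).trans ?_
    gcongr
    exact norm_toMap_sub_le p q x
  rw [hsplit]
  refine (norm_add_le _ _).trans ((add_le_add hA hD).trans ?_)
  have h2 : ‖θ‖ ≤ 1 - L := by linarith
  have h3 : 0 ≤ ‖p - q‖ := norm_nonneg _
  nlinarith [mul_nonneg h3 (mul_nonneg hR (sub_nonneg.2 (h2.trans' (norm_nonneg θ)))),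
    mul_le_mul_of_nonneg_left h2 h3]

end C1b

end C1b

/-! ### The flow equation as an autonomous equation in `C_b^1` -/

section Velocity

variable {E : Type*} [NormedAddCommGroup E] [InnerProductSpace ℝ E] [CompleteSpace E]
  {C : ℝ} {B : Current E → E → E}

/-- The vector field `u ↦ B((id + u)_♯ ξ₀) ∘ (id + u)` on `C_b^1(E, E)`. Its integral curves
issuing from `0` are the solutions of the flow equation. -/
def velocity (hB : IsDrift C B) (ξ₀ : Current E) (p : C1b E) : C1b E :=
  C1b.mk (fun x => B (p.transport ξ₀) (p.toMap x))
    (fun x => (fderiv ℝ (B (p.transport ξ₀)) (p.toMap x)).comp (p.jac x))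
    (fun x => (((hB.mem_cb _).1.differentiable two_ne_zero) _).hasFDerivAt.comp x
      (p.hasFDerivAt_toMap x))
    ((((hB.mem_cb _).1.continuous_fderiv two_ne_zero).comp p.continuous_toMap).clm_comp
      p.continuous_jac)
    (cbNorm 2 (B (p.transport ξ₀)) * (1 + ‖p‖))
    (fun _ => ((hB.mem_cb _).norm_le _).trans
      (le_mul_of_one_le_right (cbNorm_nonneg _ _) (le_add_of_nonneg_right (norm_nonneg p))))
    (fun x => (ContinuousLinearMap.opNorm_comp_le _ _).trans
      (mul_le_mul ((hB.mem_cb _).norm_fderiv_le one_le_two _) (p.norm_jac_le x) (norm_nonneg _)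
        (cbNorm_nonneg _ _)))

variable (hB : IsDrift C B) (ξ₀ : Current E)

theorem velocity_val (p : C1b E) (x : E) :
    (velocity hB ξ₀ p).val x = B (p.transport ξ₀) (p.toMap x) := rfl

theorem velocity_deriv (p : C1b E) (x : E) :
    (velocity hB ξ₀ p).deriv x = (fderiv ℝ (B (p.transport ξ₀)) (p.toMap x)).comp (p.jac x) :=
  rfl

theorem cbNorm_drift_transport_le (hB : IsDrift C B) (ξ₀ : Current E) {p : C1b E} {R : ℝ}
    (hp : ‖p‖ ≤ R) :
    cbNorm 2 (B (p.transport ξ₀)) ≤ C * (‖ξ₀‖ * (1 + R) + 1) := by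
  refine (hB.growth _).trans ?_
  have := hB.const_nonneg
  have h1 := p.weakNorm_transport_le ξ₀
  gcongr
  exact h1.trans (by gcongr)

theorem norm_velocity_le {p : C1b E} {R : ℝ} (hp : ‖p‖ ≤ R) :
    ‖velocity hB ξ₀ p‖ ≤ C * (‖ξ₀‖ * (1 + R) + 1) * (1 + R) := by
  have hR : 0 ≤ R := (norm_nonneg _).trans hp
  have hM := cbNorm_drift_transport_le hB ξ₀ hp
  have hM0 := (cbNorm_nonneg 2 _).trans hM
  refine C1b.norm_le (fun x => ?_) fun x => ?_
  · rw [velocity_val]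
    exact (((hB.mem_cb _).norm_le _).trans hM).trans (le_mul_of_one_le_right hM0 (by linarith))
  · rw [velocity_deriv]
    exact (ContinuousLinearMap.opNorm_comp_le _ _).trans
      (mul_le_mul (((hB.mem_cb _).norm_fderiv_le one_le_two _).trans hM)
        ((p.norm_jac_le x).trans (by linarith)) (norm_nonneg _) hM0)

/-- `velocity` is Lipschitz on bounded sets. The derivative component uses the Lipschitz bound on
`DB` in the current and the bound on `D²B` in space. -/
theorem norm_velocity_sub_le {p q : C1b E} {R : ℝ} (hp : ‖p‖ ≤ R) (hq : ‖q‖ ≤ R) :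
    ‖velocity hB ξ₀ p - velocity hB ξ₀ q‖ ≤
      3 * (C * (‖ξ₀‖ * (1 + R) + 1)) * (1 + R) * ‖p - q‖ := by
  have hR : 0 ≤ R := (norm_nonneg _).trans hp
  have hC := hB.const_nonneg
  set M := C * (‖ξ₀‖ * (1 + R) + 1) with hMdef
  have hM := cbNorm_drift_transport_le hB ξ₀ hq
  rw [← hMdef] at hM
  have hM0 : 0 ≤ M := (cbNorm_nonneg 2 _).trans hM
  have hd : 0 ≤ ‖p - q‖ := norm_nonneg _
  have hMd : 0 ≤ M * ‖p - q‖ := mul_nonneg hM0 hd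
  have hW : C * weakNorm (p.transport ξ₀ - q.transport ξ₀) ≤ M * ‖p - q‖ := by
    rw [hMdef, mul_assoc]
    refine mul_le_mul_of_nonneg_left ?_ hC
    refine (C1b.weakNorm_transport_sub_le ξ₀ hq).trans ?_
    gcongr
    linarith
  refine C1b.norm_le (fun x => ?_) fun x => ?_
  · rw [C1b.val_sub, velocity_val, velocity_val]
    have h1 := (hB.norm_sub_le (p.transport ξ₀) (q.transport ξ₀) (p.toMap x)).trans hW
    have h2 : ‖B (q.transport ξ₀) (p.toMap x) - B (q.transport ξ₀) (q.toMap x)‖ ≤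
        M * ‖p - q‖ :=
      ((hB.mem_cb _).norm_sub_le one_le_two _ _).trans
        (mul_le_mul hM (C1b.norm_toMap_sub_le p q x) (norm_nonneg _) hM0)
    refine (norm_sub_le_norm_sub_add_norm_sub _ _ _).trans ((add_le_add h1 h2).trans ?_)
    nlinarith
  · rw [C1b.deriv_sub, velocity_deriv, velocity_deriv]
    have h1 := (hB.norm_fderiv_sub_le (p.transport ξ₀) (q.transport ξ₀) (p.toMap x)).trans hW
    have h2 : ‖fderiv ℝ (B (q.transport ξ₀)) (p.toMap x) -
        fderiv ℝ (B (q.transport ξ₀)) (q.toMap x)‖ ≤ M * ‖p - q‖ :=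
      ((hB.mem_cb _).norm_fderiv_sub_le _ _).trans
        (mul_le_mul hM (C1b.norm_toMap_sub_le p q x) (norm_nonneg _) hM0)
    have h3 := (norm_sub_le_norm_sub_add_norm_sub _ _ _).trans (add_le_add h1 h2)
    have h4 : ‖fderiv ℝ (B (q.transport ξ₀)) (q.toMap x)‖ ≤ M :=
      ((hB.mem_cb _).norm_fderiv_le one_le_two _).trans hM
    have hsplit : (fderiv ℝ (B (p.transport ξ₀)) (p.toMap x)).comp (p.jac x) -
        (fderiv ℝ (B (q.transport ξ₀)) (q.toMap x)).comp (q.jac x) =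
        (fderiv ℝ (B (p.transport ξ₀)) (p.toMap x) -
          fderiv ℝ (B (q.transport ξ₀)) (q.toMap x)).comp (p.jac x) +
        (fderiv ℝ (B (q.transport ξ₀)) (q.toMap x)).comp (p.jac x - q.jac x) := by
      simp only [ContinuousLinearMap.sub_comp, ContinuousLinearMap.comp_sub]
      abel
    rw [hsplit]
    have h5 := (ContinuousLinearMap.opNorm_comp_le _ (p.jac x)).trans
      (mul_le_mul h3 ((p.norm_jac_le x).trans (add_le_add_right hp 1)) (norm_nonneg _)
        (add_nonneg hMd hMd))
    have h6 := (ContinuousLinearMap.opNorm_comp_le _ (p.jac x - q.jac x)).trans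
      (mul_le_mul h4 (C1b.norm_jac_sub_le p q x) (norm_nonneg _) hM0)
    refine (norm_add_le _ _).trans ((add_le_add h5 h6).trans ?_)
    nlinarith [mul_nonneg hMd hR]

theorem lipschitzOnWith_velocity (R : ℝ) :
    ∃ K : ℝ≥0, LipschitzOnWith K (velocity hB ξ₀) (Metric.closedBall 0 R) := by
  refine ⟨(3 * (C * (‖ξ₀‖ * (1 + R) + 1)) * (1 + R)).toNNReal,
    LipschitzOnWith.of_dist_le_mul fun p hp q hq => ?_⟩
  rw [mem_closedBall_zero_iff] at hp hq
  rw [dist_eq_norm, dist_eq_norm]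
  exact (norm_velocity_sub_le hB ξ₀ hp hq).trans
    (mul_le_mul_of_nonneg_right (Real.le_coe_toNNReal _) (norm_nonneg _))

theorem continuous_velocity : Continuous (velocity hB ξ₀) := by
  refine continuous_iff_continuousAt.2 fun p => ?_
  obtain ⟨K, hK⟩ := lipschitzOnWith_velocity hB ξ₀ (‖p‖ + 1)
  refine hK.continuousOn.continuousAt (Metric.closedBall_mem_nhds_of_mem ?_)
  rw [mem_ball_zero_iff]
  linarith

/-- `p` is an integral curve of `velocity` on `[0, T]` issuing from `0`. -/
def IsCurve (T : ℝ) (p : ℝ → C1b E) : Prop :=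
  p 0 = 0 ∧ ∀ t ∈ Icc 0 T, HasDerivWithinAt p (velocity hB ξ₀ (p t)) (Icc 0 T) t

theorem IsCurve.continuousOn {T : ℝ} {p : ℝ → C1b E} (hp : IsCurve hB ξ₀ T p) :
    ContinuousOn p (Icc 0 T) := fun t ht => (hp.2 t ht).continuousWithinAt

/-- Picard–Lindelöf in `C_b^1`, on the unit ball. -/
theorem exists_isCurve {T : ℝ} (hT : 0 ≤ T) (hTC : 2 * (C * (2 * ‖ξ₀‖ + 1)) * T ≤ 1) :
    ∃ p, IsCurve hB ξ₀ T p := by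
  obtain ⟨K, hK⟩ := lipschitzOnWith_velocity hB ξ₀ 1
  have hL0 : 0 ≤ 2 * (C * (2 * ‖ξ₀‖ + 1)) := by
    have := hB.const_nonneg
    positivity
  have hPL : IsPicardLindelof (fun _ => velocity hB ξ₀) (⟨0, le_rfl, hT⟩ : Icc 0 T) 0 1 0
      (2 * (C * (2 * ‖ξ₀‖ + 1))).toNNReal K := by
    refine IsPicardLindelof.of_time_independent (fun p hp => ?_) (by simpa using hK) ?_
    · have hp' : ‖p‖ ≤ 1 := by simpa using hp
      rw [Real.coe_toNNReal _ hL0]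
      refine (norm_velocity_le hB ξ₀ hp').trans (le_of_eq ?_)
      ring
    · simpa [Real.coe_toNNReal _ hL0, hT] using hTC
  exact hPL.exists_eq_forall_mem_Icc_hasDerivWithinAt₀

theorem IsCurve.eqOn {T : ℝ} {p q : ℝ → C1b E} (hp : IsCurve hB ξ₀ T p)
    (hq : IsCurve hB ξ₀ T q) : EqOn p q (Icc 0 T) := by
  obtain ⟨R₁, h₁⟩ := isCompact_Icc.exists_bound_of_continuousOn (hp.continuousOn hB ξ₀)
  obtain ⟨R₂, h₂⟩ := isCompact_Icc.exists_bound_of_continuousOn (hq.continuousOn hB ξ₀)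
  obtain ⟨K, hK⟩ := lipschitzOnWith_velocity hB ξ₀ (max R₁ R₂)
  have hright : ∀ {r : ℝ → C1b E}, IsCurve hB ξ₀ T r → ∀ t ∈ Ico 0 T,
      HasDerivWithinAt r (velocity hB ξ₀ (r t)) (Ici t) t := fun hr t ht =>
    (hr.2 t (Ico_subset_Icc_self ht)).mono_of_mem_nhdsWithin
      (mem_of_superset (Icc_mem_nhdsGE ht.2) (Icc_subset_Icc_left ht.1))
  refine ODE_solution_unique_of_mem_Icc_right (v := fun _ => velocity hB ξ₀)
    (s := fun _ => Metric.closedBall 0 (max R₁ R₂)) (fun _ _ => hK) (hp.continuousOn hB ξ₀)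
    (hright hp) (fun t ht => ?_) (hq.continuousOn hB ξ₀) (hright hq) (fun t ht => ?_)
    (hp.1.trans hq.1.symm)
  · exact mem_closedBall_zero_iff.2 ((h₁ t (Ico_subset_Icc_self ht)).trans (le_max_left _ _))
  · exact mem_closedBall_zero_iff.2 ((h₂ t (Ico_subset_Icc_self ht)).trans (le_max_right _ _))

/-- Evaluating an integral curve of `velocity` at the points of `E` gives the flow of the drift. -/
theorem IsCurve.isSolution {T : ℝ} {p : ℝ → C1b E} (hp : IsCurve hB ξ₀ T p) :
    IsSolution B ξ₀ T (fun t => (p t).transport ξ₀) where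
  continuous s hs := by
    have h := tendsto_iff_norm_sub_tendsto_zero.1 (hp.continuousOn hB ξ₀ s hs)
    refine squeeze_zero (fun _ => weakNorm_nonneg _)
      (fun t => C1b.weakNorm_transport_sub_le ξ₀ le_rfl) ?_
    simpa using h.const_mul (‖ξ₀‖ * (1 + ‖p s‖))
  flow_eq := by
    refine ⟨fun t => (p t).toMap, fun x => ⟨?_, fun t ht => ?_⟩, fun t _ =>
      ⟨(p t).isPushable, rfl⟩⟩
    · simp only [hp.1]
      exact add_zero x
    · exact ((C1b.eval x).hasFDerivAt.comp_hasDerivWithinAt t (hp.2 t ht)).const_add x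

end Velocity

/-! ### Flows of bounded Lipschitz vector fields -/

section Flow

variable {E : Type*} [NormedAddCommGroup E] [InnerProductSpace ℝ E] {T M : ℝ} {b : ℝ → E → E}
  {φ : ℝ → E → E}

theorem IsFlow.norm_sub_le_time (hφ : IsFlow T b φ) (hb : ∀ t ∈ Icc 0 T, ∀ x, ‖b t x‖ ≤ M)
    {s t : ℝ} (hs : s ∈ Icc 0 T) (ht : t ∈ Icc 0 T) (x : E) :
    ‖φ t x - φ s x‖ ≤ M * |t - s| :=
  (convex_Icc 0 T).norm_image_sub_le_of_norm_hasDerivWithin_le (f := fun r => φ r x)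
    (fun r hr => (hφ x).2 r hr) (fun r hr => hb r hr _) hs ht

theorem IsFlow.norm_sub_le_space (hφ : IsFlow T b φ)
    (hL : ∀ t ∈ Icc 0 T, ∀ x y, ‖b t x - b t y‖ ≤ M * ‖x - y‖) (hM : 0 ≤ M) {t : ℝ}
    (ht : t ∈ Icc 0 T) (x y : E) : ‖φ t x - φ t y‖ ≤ ‖x - y‖ * Real.exp (M * T) := by
  have hcont : ∀ z, ContinuousOn (fun r => φ r z) (Icc 0 T) := fun z r hr =>
    ((hφ z).2 r hr).continuousWithinAt
  have hright : ∀ z, ∀ r ∈ Ico 0 T, HasDerivWithinAt (fun r => φ r z) (b r (φ r z)) (Ici r) r :=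
    fun z r hr => ((hφ z).2 r (Ico_subset_Icc_self hr)).mono_of_mem_nhdsWithin
      (mem_of_superset (Icc_mem_nhdsGE hr.2) (Icc_subset_Icc_left hr.1))
  have h := dist_le_of_trajectories_ODE_of_mem (v := b) (K := M.toNNReal) (s := fun _ => univ)
    (fun r hr => LipschitzOnWith.of_dist_le_mul fun z _ w _ => by
      rw [dist_eq_norm, dist_eq_norm, Real.coe_toNNReal _ hM]
      exact hL r (Ico_subset_Icc_self hr) z w)
    (hcont x) (hright x) (fun _ _ => mem_univ _) (hcont y) (hright y) (fun _ _ => mem_univ _)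
    le_rfl t ht
  rw [(hφ x).1, (hφ y).1, dist_eq_norm, dist_eq_norm, Real.coe_toNNReal _ hM, sub_zero] at h
  refine h.trans ?_
  gcongr
  exact ht.2

/-- The Lipschitz constant in space of `φ_t - φ_s` is `O(|t - s|)`. -/
theorem IsFlow.norm_sub_sub_le (hφ : IsFlow T b φ)
    (hL : ∀ t ∈ Icc 0 T, ∀ x y, ‖b t x - b t y‖ ≤ M * ‖x - y‖) (hM : 0 ≤ M) {s t : ℝ}
    (hs : s ∈ Icc 0 T) (ht : t ∈ Icc 0 T) (x y : E) :
    ‖(φ t x - φ s x) - (φ t y - φ s y)‖ ≤ M * Real.exp (M * T) * |t - s| * ‖x - y‖ := by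
  have h := (convex_Icc 0 T).norm_image_sub_le_of_norm_hasDerivWithin_le
    (f := fun r => φ r x - φ r y) (C := M * (‖x - y‖ * Real.exp (M * T)))
    (fun r hr => ((hφ x).2 r hr).sub ((hφ y).2 r hr))
    (fun r hr => (hL r hr _ _).trans
      (mul_le_mul_of_nonneg_left (hφ.norm_sub_le_space hL hM hr x y) hM)) hs ht
  rw [sub_sub_sub_comm]
  refine h.trans (le_of_eq ?_)
  rw [Real.norm_eq_abs]
  ring

theorem IsFlow.norm_fderiv_sub_le (hφ : IsFlow T b φ)
    (hL : ∀ t ∈ Icc 0 T, ∀ x y, ‖b t x - b t y‖ ≤ M * ‖x - y‖) (hM : 0 ≤ M)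
    (hd : ∀ t ∈ Icc 0 T, Differentiable ℝ (φ t)) {s t : ℝ} (hs : s ∈ Icc 0 T)
    (ht : t ∈ Icc 0 T) (x : E) :
    ‖fderiv ℝ (φ t) x - fderiv ℝ (φ s) x‖ ≤ M * Real.exp (M * T) * |t - s| := by
  rw [← fderiv_fun_sub (hd t ht x) (hd s hs x)]
  exact norm_fderiv_le_of_lip' ℝ (by positivity)
    (Eventually.of_forall fun y => hφ.norm_sub_sub_le hL hM hs ht y x)

/-- A flow of `C¹` maps, generated by a bounded field that is Lipschitz in space, is a continuous
curve in `id + C_b^1`. -/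
theorem IsFlow.exists_continuous_C1b (hφ : IsFlow T b φ) (hT : 0 ≤ T)
    (hb : ∀ t ∈ Icc 0 T, ∀ x, ‖b t x‖ ≤ M)
    (hL : ∀ t ∈ Icc 0 T, ∀ x y, ‖b t x - b t y‖ ≤ M * ‖x - y‖) (hM : 0 ≤ M)
    (hd : ∀ t ∈ Icc 0 T, ContDiff ℝ 1 (φ t)) :
    ∃ p : ℝ → C1b E, Continuous p ∧ ∀ t ∈ Icc 0 T, (p t).toMap = φ t := by
  have h0 : (0 : ℝ) ∈ Icc 0 T := ⟨le_rfl, hT⟩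
  have hdiff : ∀ t ∈ Icc 0 T, Differentiable ℝ (φ t) := fun t ht =>
    (hd t ht).differentiable one_ne_zero
  have hφ0 : φ 0 = id := funext fun x => (hφ x).1
  set c := M + M * Real.exp (M * T) with hc
  have hc1 : M ≤ c := le_add_of_nonneg_right (by positivity)
  have hc2 : M * Real.exp (M * T) ≤ c := le_add_of_nonneg_left hM
  have hex : ∀ t : Icc 0 T, ∃ q : C1b E, q.toMap = φ t := fun ⟨t, ht⟩ => by
    refine ⟨C1b.mk (fun x => φ t x - x) (fun x => fderiv ℝ (φ t) x - ContinuousLinearMap.id ℝ E)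
      (fun x => (hdiff t ht x).hasFDerivAt.sub (hasFDerivAt_id x))
      (((hd t ht).continuous_fderiv one_ne_zero).sub continuous_const) (c * |t - 0|)
      (fun x => ?_) (fun x => ?_), funext fun x => add_sub_cancel x (φ t x)⟩
    · have h := hφ.norm_sub_le_time hb h0 ht x
      rw [(hφ x).1] at h
      exact h.trans (by gcongr)
    · have h := hφ.norm_fderiv_sub_le hL hM hdiff h0 ht x
      rw [hφ0, fderiv_id] at h
      exact h.trans (by gcongr)
  choose P hP using hex
  have hLip : LipschitzWith c.toNNReal P := LipschitzWith.of_dist_le_mul fun t s => by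
    rw [Real.coe_toNNReal _ (hM.trans hc1), dist_eq_norm, Subtype.dist_eq, Real.dist_eq]
    refine C1b.norm_le (fun x => ?_) fun x => ?_
    · have h := hφ.norm_sub_le_time hb s.2 t.2 x
      rw [← hP t, ← hP s, C1b.toMap, C1b.toMap, add_sub_add_left_eq_sub] at h
      exact h.trans (by gcongr)
    · have h := hφ.norm_fderiv_sub_le hL hM hdiff s.2 t.2 x
      rw [← hP t, ← hP s, C1b.fderiv_toMap, C1b.fderiv_toMap, C1b.jac, C1b.jac,
        add_sub_add_left_eq_sub] at h
      exact h.trans (by gcongr)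
  refine ⟨IccExtend hT P, hLip.continuous.Icc_extend', fun t ht => ?_⟩
  rw [IccExtend_of_mem hT P ht, hP]

end Flow

/-! ### Existence and uniqueness of solutions -/

section Curve

variable {E : Type*} [NormedAddCommGroup E] [InnerProductSpace ℝ E] [CompleteSpace E]
  {C : ℝ} {B : Current E → E → E} (hB : IsDrift C B) (ξ₀ : Current E)

/-- Every solution of the flow equation comes from an integral curve of `velocity`. The equation
in `C_b^1` is obtained in integrated form, which only needs to be checked pointwise because an
element of `C_b^1` is determined by its values. -/
theorem IsSolution.exists_isCurve {T : ℝ} (hT : 0 ≤ T) {ξ : ℝ → Current E}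
    (hξ : IsSolution B ξ₀ T ξ) :
    ∃ p, IsCurve hB ξ₀ T p ∧ ∀ t ∈ Icc 0 T, ξ t = (p t).transport ξ₀ := by
  obtain ⟨φ, hφ, hpush⟩ := hξ.flow_eq
  have hC := hB.const_nonneg
  obtain ⟨w, hw⟩ := isCompact_Icc.exists_bound_of_continuousOn
    hξ.continuous.continuousOn_weakNorm
  have hM : ∀ t ∈ Icc 0 T, cbNorm 2 (B (ξ t)) ≤ C * (w + 1) := fun t ht =>
    (hB.growth _).trans (by
      have := (Real.le_norm_self _).trans (hw t ht)
      gcongr)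
  have h0 : (0 : ℝ) ∈ Icc 0 T := ⟨le_rfl, hT⟩
  obtain ⟨p, hp, hpφ⟩ := hφ.exists_continuous_C1b hT
    (fun t ht x => ((hB.mem_cb _).norm_le x).trans (hM t ht))
    (fun t ht x y => ((hB.mem_cb _).norm_sub_le one_le_two x y).trans
      (mul_le_mul_of_nonneg_right (hM t ht) (norm_nonneg _)))
    ((cbNorm_nonneg 2 _).trans (hM 0 h0))
    (fun t ht => (hpush t ht).choose.contDiff)
  have hξp : ∀ t ∈ Icc 0 T, ξ t = (p t).transport ξ₀ := fun t ht => by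
    obtain ⟨hφt, h⟩ := hpush t ht
    rw [h, C1b.transport_eq_push ξ₀ (p t) hφt (hpφ t ht)]
  have hv : Continuous fun t => velocity hB ξ₀ (p t) := (continuous_velocity hB ξ₀).comp hp
  set q : ℝ → C1b E := fun t => ∫ s in (0 : ℝ)..t, velocity hB ξ₀ (p s) with hq
  have hq' : ∀ t, HasDerivAt q (velocity hB ξ₀ (p t)) t := fun t =>
    (hv.integral_hasStrictDerivAt 0 t).hasDerivAt
  have hq0 : q 0 = 0 := intervalIntegral.integral_same
  have hqp : ∀ t ∈ Icc 0 T, q t = p t := fun t ht => C1b.ext_val fun x => by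
    have hqd : ∀ r, HasDerivAt (fun r => x + (q r).val x) ((velocity hB ξ₀ (p r)).val x) r :=
      fun r => ((C1b.eval x).hasFDerivAt.comp_hasDerivAt r (hq' r)).const_add x
    have h := eq_of_has_deriv_right_eq (f := fun r => x + (q r).val x) (g := fun r => φ r x)
      (f' := fun r => (velocity hB ξ₀ (p r)).val x) (a := 0) (b := T)
      (fun r _ => (hqd r).hasDerivWithinAt)
      (fun r hr => by
        have hr' := Ico_subset_Icc_self hr
        have h1 := ((hφ x).2 r hr').mono_of_mem_nhdsWithin
          (mem_of_superset (Icc_mem_nhdsGE hr.2) (Icc_subset_Icc_left hr.1))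
        rwa [velocity_val, ← hξp r hr', hpφ r hr'])
      (fun r _ => (hqd r).continuousAt.continuousWithinAt)
      (fun r hr => ((hφ x).2 r hr).continuousWithinAt)
      (by rw [hq0, (hφ x).1]; exact add_zero x) t ht
    rw [← hpφ t ht] at h
    exact add_left_cancel h
  refine ⟨p, ⟨by rw [← hqp 0 h0, hq0], fun t ht => ?_⟩, hξp⟩
  exact (hq' t).hasDerivWithinAt.congr (fun r hr => (hqp r hr).symm) (hqp t ht).symm

/-- Existence and uniqueness for the flow equation on a time interval whose length is controlled
by the constant of the drift and the strong norm of the initial current. -/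
theorem exists_unique_isSolution (hB : IsDrift C B) (ξ₀ : Current E) {T : ℝ} (hT : 0 ≤ T)
    (hTC : 2 * (C * (2 * ‖ξ₀‖ + 1)) * T ≤ 1) :
    ∃ ξ, IsSolution B ξ₀ T ξ ∧ ∀ ξ', IsSolution B ξ₀ T ξ' → EqOn ξ' ξ (Icc 0 T) := by
  obtain ⟨p, hp⟩ := CurrentFlow.exists_isCurve hB ξ₀ hT hTC
  refine ⟨_, hp.isSolution hB ξ₀, fun ξ' hξ' t ht => ?_⟩
  obtain ⟨q, hq, hξq⟩ := hξ'.exists_isCurve hB ξ₀ hT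
  rw [hξq t ht, hq.eqOn hB ξ₀ hp ht]

end Curve

/-! ### Translations of bounded functions -/

section Translate

variable {E W : Type*} [NormedAddCommGroup E] [NormedAddCommGroup W]

/-- The function `y ↦ g(x - y)`. -/
def translate (g : Bdd E W) (x : E) : Bdd E W :=
  g.compContinuous ⟨fun y => x - y, continuous_const.sub continuous_id⟩

@[simp]
theorem translate_apply (g : Bdd E W) (x y : E) : translate g x y = g (x - y) := rfl

theorem continuous_translate {g : Bdd E W} {L : ℝ≥0} (hg : LipschitzWith L g) :
    Continuous (translate g) := by
  refine LipschitzWith.continuous (K := L) (LipschitzWith.of_dist_le_mul fun x x' => ?_)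
  refine (BoundedContinuousFunction.dist_le (by positivity)).2 fun y => ?_
  simpa using hg.dist_le_mul (x - y) (x' - y)

theorem lipschitzWith_translate {g : Bdd E W} {L : ℝ≥0} (hg : LipschitzWith L g) (x : E) :
    LipschitzWith L (translate g x) :=
  LipschitzWith.of_dist_le_mul fun y y' =>
    (hg.dist_le_mul (x - y) (x - y')).trans_eq (by rw [dist_sub_left])

variable [NormedSpace ℝ E] [NormedSpace ℝ W]

/-- The space `L(E, W)` of continuous linear maps between normed spaces, with the topology of the
norm. -/
abbrev Lin (E W : Type*) [NormedAddCommGroup E] [NormedSpace ℝ E] [NormedAddCommGroup W]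
    [NormedSpace ℝ W] := E →L[ℝ] W

/-- A bounded function with values in `L(E, W)`, seen as a linear map `E → C_b(E, W)`. -/
def flipCLM (E W : Type*) [NormedAddCommGroup E] [NormedSpace ℝ E] [NormedAddCommGroup W]
    [NormedSpace ℝ W] : Bdd E (E →L[ℝ] W) →L[ℝ] (E →L[ℝ] Bdd E W) :=
  LinearMap.mkContinuous₂
    (LinearMap.mk₂ ℝ
      (fun (g : Bdd E (E →L[ℝ] W)) (h : E) =>
        (ContinuousLinearMap.apply ℝ W h).compLeftContinuousBounded E g)
      (fun g g' h => rfl) (fun c g h => rfl)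
      (fun g h h' => by ext y; simp) (fun c g h => by ext y; simp)) 1
    (fun g h => by
      rw [one_mul]
      exact (BoundedContinuousFunction.norm_le (by positivity)).2 fun y =>
        ((g y).le_opNorm h).trans (by gcongr; exact g.norm_coe_le_norm y))

@[simp]
theorem flipCLM_apply (g : Bdd E (E →L[ℝ] W)) (h y : E) : flipCLM E W g h y = g y h := rfl

/-- The translates of a `C^{1,1}` function are differentiable in the uniform norm, uniformly
because the derivative is Lipschitz. -/
theorem hasFDerivAt_translate {g : Bdd E W} {g' : Bdd E (E →L[ℝ] W)} {L : ℝ≥0}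
    (hg : ∀ x, HasFDerivAt g (g' x) x) (hL : LipschitzWith L g') (x : E) :
    HasFDerivAt (translate g) (flipCLM E W (translate g' x)) x := by
  refine .of_isLittleO (Asymptotics.isLittleO_iff.2 fun ε hε => ?_)
  have hev : ∀ᶠ x' in 𝓝 x, L * ‖x' - x‖ ≤ ε := by
    have : Tendsto (fun x' => (L : ℝ) * ‖x' - x‖) (𝓝 x) (𝓝 (L * ‖x - x‖)) :=
      ((continuous_id.sub continuous_const).norm.const_mul _).tendsto x
    rw [sub_self, norm_zero, mul_zero] at this
    exact this.eventually_le_const hε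
  filter_upwards [hev] with x' hx'
  refine (BoundedContinuousFunction.norm_le (by positivity)).2 fun y => ?_
  have h := (convex_segment (x - y) (x' - y)).norm_image_sub_le_of_norm_hasFDerivWithin_le'
    (f := g) (f' := g') (φ := g' (x - y)) (C := ε) (fun z _ => (hg z).hasFDerivWithinAt)
    (fun z hz => (hL.norm_sub_le _ _).trans (le_trans ?_ hx'))
    (left_mem_segment ℝ _ _) (right_mem_segment ℝ _ _)
  · simpa using h
  · gcongr
    have := norm_sub_le_of_mem_segment hz
    simpa using this

variable {V : Type*} [NormedAddCommGroup V] [NormedSpace ℝ V]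

/-- The map `g ↦ (h ↦ Λ(g(·) h))`, through which `Λ` acts on derivatives. -/
def lift (Λ : Bdd E W →L[ℝ] V) : Bdd E (Lin E W) →L[ℝ] Lin E V :=
  (ContinuousLinearMap.compL ℝ E (Bdd E W) V Λ).comp (flipCLM E W)

theorem hasFDerivAt_apply_translate (Λ : Bdd E W →L[ℝ] V) {g : Bdd E W}
    {g' : Bdd E (E →L[ℝ] W)} {L : ℝ≥0} (hg : ∀ x, HasFDerivAt g (g' x) x)
    (hL : LipschitzWith L g') (x : E) :
    HasFDerivAt (fun x => Λ (translate g x)) (lift Λ (translate g' x)) x :=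
  Λ.hasFDerivAt.comp x (hasFDerivAt_translate hg hL x)

theorem fderiv_apply_translate (Λ : Bdd E W →L[ℝ] V) {g : Bdd E W}
    {g' : Bdd E (E →L[ℝ] W)} {L : ℝ≥0} (hg : ∀ x, HasFDerivAt g (g' x) x)
    (hL : LipschitzWith L g') :
    fderiv ℝ (fun x => Λ (translate g x)) = fun x => lift Λ (translate g' x) :=
  funext fun x => (hasFDerivAt_apply_translate Λ hg hL x).fderiv

end Translate

/-! ### Bounds of all derivatives up to a given order -/

section CbBound

variable {E : Type*} [NormedAddCommGroup E] [NormedSpace ℝ E]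
  {F : Type*} [NormedAddCommGroup F] [NormedSpace ℝ F]

/-- `f` is of class `C^k` and its derivatives of order up to `k` are bounded by `c`. -/
def HasCbBound (k : ℕ) (c : ℝ) (f : E → F) : Prop :=
  ContDiff ℝ k f ∧ ∀ j ≤ k, ∀ x, ‖iteratedFDeriv ℝ j f x‖ ≤ c

theorem HasCbBound.sum {ι : Type*} {s : Finset ι} {k : ℕ} {c : ι → ℝ} {f : ι → E → F}
    (h : ∀ i ∈ s, HasCbBound k (c i) (f i)) :
    HasCbBound k (∑ i ∈ s, c i) (fun x => ∑ i ∈ s, f i x) := by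
  refine ⟨ContDiff.sum fun i hi => (h i hi).1, fun j hj x => ?_⟩
  rw [iteratedFDeriv_fun_sum_apply
    (fun i hi => ((h i hi).1.of_le (by exact_mod_cast hj)).contDiffAt)]
  exact (norm_sum_le _ _).trans (Finset.sum_le_sum fun i hi => (h i hi).2 j hj x)

theorem HasCbBound.clm_comp {G : Type*} [NormedAddCommGroup G] [NormedSpace ℝ G] {k : ℕ} {c : ℝ}
    {f : E → F} (h : HasCbBound k c f) (A : F →L[ℝ] G) :
    HasCbBound k (‖A‖ * c) (fun x => A (f x)) := by
  refine ⟨A.contDiff.comp h.1, fun j hj x => ?_⟩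
  exact (A.norm_iteratedFDeriv_comp_left h.1.contDiffAt (by exact_mod_cast hj)).trans
    (mul_le_mul_of_nonneg_left (h.2 j hj x) (norm_nonneg A))

theorem lipschitzWith_of_norm_iteratedFDeriv_one_le {f : E → F} {c : ℝ≥0} (hf : ContDiff ℝ 1 f)
    (hc : ∀ x, ‖iteratedFDeriv ℝ 1 f x‖ ≤ c) : LipschitzWith c f :=
  lipschitzWith_of_nnnorm_fderiv_le (hf.differentiable one_ne_zero) fun x => by
    rw [← NNReal.coe_le_coe, coe_nnnorm, ← norm_iteratedFDeriv_one]
    exact hc x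

/-- The functional `Λ` on scalar functions is bounded by `A` times the maximum of the sup norm
and the Lipschitz constant. -/
def IsLipBounded (A : ℝ) (Λ : Bdd E ℝ →L[ℝ] ℝ) : Prop :=
  ∀ (θ : Bdd E ℝ) (s : ℝ≥0), (∀ y, ‖θ y‖ ≤ s) → LipschitzWith s θ → ‖Λ θ‖ ≤ A * s

variable {A : ℝ} {c : ℝ≥0} {Λ : Bdd E ℝ →L[ℝ] ℝ}

theorem lipschitzWith_flipCLM {g : Bdd E (E →L[ℝ] F)} (hg : LipschitzWith c g) (h : E) :
    LipschitzWith (c * ‖h‖₊) (flipCLM E F g h) :=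
  LipschitzWith.of_dist_le_mul fun y y' => by
    have := hg.norm_sub_le y y'
    rw [dist_eq_norm, dist_eq_norm, NNReal.coe_mul, coe_nnnorm, mul_right_comm]
    exact (g y - g y').le_of_opNorm_le this h

theorem norm_flipCLM_le {g : Bdd E (E →L[ℝ] F)} (hg : ∀ y, ‖g y‖ ≤ c) (h y : E) :
    ‖flipCLM E F g h y‖ ≤ (c * ‖h‖₊ : ℝ≥0) :=
  (g y).le_of_opNorm_le (hg y) h

theorem IsLipBounded.norm_lift_le (hΛ : IsLipBounded A Λ) (hA : 0 ≤ A)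
    {g : Bdd E (E →L[ℝ] ℝ)} (hg : ∀ y, ‖g y‖ ≤ c) (hL : LipschitzWith c g) :
    ‖lift Λ g‖ ≤ A * c :=
  ContinuousLinearMap.opNorm_le_bound _ (by positivity) fun h =>
    (hΛ _ _ (norm_flipCLM_le hg h) (lipschitzWith_flipCLM hL h)).trans
      (le_of_eq (by rw [NNReal.coe_mul, coe_nnnorm, mul_assoc]))

theorem IsLipBounded.norm_lift_lift_le (hΛ : IsLipBounded A Λ) (hA : 0 ≤ A)
    {g : Bdd E (Lin E (Lin E ℝ))} (hg : ∀ y, ‖g y‖ ≤ c) (hL : LipschitzWith c g) :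
    ‖lift (W := Lin E ℝ) (V := Lin E ℝ) (lift Λ) g‖ ≤ A * c :=
  ContinuousLinearMap.opNorm_le_bound _ (by positivity) fun h =>
    (hΛ.norm_lift_le hA (norm_flipCLM_le hg h) (lipschitzWith_flipCLM hL h)).trans
      (le_of_eq (by rw [NNReal.coe_mul, coe_nnnorm, mul_assoc]))

theorem IsLipBounded.hasCbBound_of_derivatives (hΛ : IsLipBounded A Λ) (hA : 0 ≤ A)
    {k : Bdd E ℝ} {k₁ : Bdd E (E →L[ℝ] ℝ)} {k₂ : Bdd E (Lin E (Lin E ℝ))}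
    (hd1 : ∀ x, HasFDerivAt k (k₁ x) x) (hd2 : ∀ x, HasFDerivAt k₁ (k₂ x) x)
    (hb0 : ∀ x, ‖k x‖ ≤ c) (hb1 : ∀ x, ‖k₁ x‖ ≤ c) (hb2 : ∀ x, ‖k₂ x‖ ≤ c)
    (hL0 : LipschitzWith c k) (hL1 : LipschitzWith c k₁) (hL2 : LipschitzWith c k₂) :
    HasCbBound 2 (A * c) (fun x => Λ (translate k x)) := by
  have hf1 := fderiv_apply_translate Λ hd1 hL1
  have hf2 := fderiv_apply_translate (W := Lin E ℝ) (V := Lin E ℝ) (lift Λ) hd2 hL2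
  have hcont2 : Continuous fun x => lift (W := Lin E ℝ) (V := Lin E ℝ) (lift Λ) (translate k₂ x) :=
    (lift (W := Lin E ℝ) (V := Lin E ℝ) (lift Λ)).continuous.comp (continuous_translate hL2)
  refine ⟨?_, fun j hj x => ?_⟩
  · refine (contDiff_succ_iff_hasFDerivAt (n := 1)).2 ⟨fun x => lift Λ (translate k₁ x), ?_,
      hasFDerivAt_apply_translate Λ hd1 hL1⟩
    exact contDiff_one_iff_hasFDerivAt.2
      ⟨_, hcont2, hasFDerivAt_apply_translate (W := Lin E ℝ) (V := Lin E ℝ) (lift Λ) hd2 hL2⟩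
  · interval_cases j
    · rw [norm_iteratedFDeriv_zero]
      exact hΛ _ c (fun y => hb0 _) (lipschitzWith_translate hL0 x)
    · rw [norm_iteratedFDeriv_one, hf1]
      exact hΛ.norm_lift_le hA (fun y => hb1 _) (lipschitzWith_translate hL1 x)
    · rw [← norm_iteratedFDeriv_fderiv, norm_iteratedFDeriv_one, hf1, hf2]
      exact hΛ.norm_lift_lift_le hA (fun y => hb2 _) (lipschitzWith_translate hL2 x)

/-- For `k ∈ C_b^3` and a functional `Λ` bounded in the Lipschitz norm, the function
`x ↦ Λ(k(x - ·))` is of class `C_b^2`, with derivatives `Λ(D^j k(x - ·))`. The third derivative of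
`k` serves as the Lipschitz constant of the second one. -/
theorem IsLipBounded.hasCbBound_apply_translate (hΛ : IsLipBounded A Λ) (hA : 0 ≤ A)
    {k : Bdd E ℝ} (hk : HasCbBound 3 c k) : HasCbBound 2 (A * c) (fun x => Λ (translate k x)) := by
  have hC1 : ContDiff ℝ 2 (fderiv ℝ k) := hk.1.fderiv_right (by norm_num)
  have hC2 : ContDiff ℝ 1 (fderiv ℝ (fderiv ℝ k)) := hC1.fderiv_right (by norm_num)
  have hb1 : ∀ x, ‖fderiv ℝ k x‖ ≤ c := fun x => by
    rw [← norm_iteratedFDeriv_one]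
    exact hk.2 1 (by norm_num) x
  have hb2 : ∀ x, ‖fderiv ℝ (fderiv ℝ k) x‖ ≤ c := fun x => by
    rw [← norm_iteratedFDeriv_one, norm_iteratedFDeriv_fderiv]
    exact hk.2 2 (by norm_num) x
  refine hΛ.hasCbBound_of_derivatives hA
    (k₁ := .ofNormedAddCommGroup (fderiv ℝ k) hC1.continuous c hb1)
    (k₂ := .ofNormedAddCommGroup (fderiv ℝ (fderiv ℝ k)) hC2.continuous c hb2)
    (fun x => (hk.1.differentiable (by norm_num) x).hasFDerivAt)
    (fun x => (hC1.differentiable (by norm_num) x).hasFDerivAt)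
    (fun x => ?_) hb1 hb2 ?_ ?_ ?_
  · rw [← norm_iteratedFDeriv_zero (𝕜 := ℝ)]
    exact hk.2 0 (by norm_num) x
  · exact lipschitzWith_of_norm_iteratedFDeriv_one_le (hk.1.of_le (by norm_num))
      (hk.2 1 (by norm_num))
  · refine lipschitzWith_of_norm_iteratedFDeriv_one_le (f := fderiv ℝ k)
      (hC1.of_le (by norm_num)) fun x => ?_
    rw [norm_iteratedFDeriv_fderiv]
    exact hk.2 2 (by norm_num) x
  · refine lipschitzWith_of_norm_iteratedFDeriv_one_le (f := fderiv ℝ (fderiv ℝ k)) hC2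
      fun x => ?_
    rw [norm_iteratedFDeriv_fderiv, norm_iteratedFDeriv_fderiv]
    exact hk.2 3 le_rfl x

end CbBound

/-! ### Convolutions with currents -/

section Convolution

variable {E : Type*} [NormedAddCommGroup E] [InnerProductSpace ℝ E]
  {F : Type*} [NormedAddCommGroup F] [NormedSpace ℝ F]

theorem HasCbBound.isCb {k : ℕ} {c : ℝ} {f : E → F} (h : HasCbBound k c f) : IsCb k f :=
  ⟨h.1, fun j hj => ⟨c, h.2 j hj⟩⟩

theorem HasCbBound.cbNorm_le {k : ℕ} {c : ℝ} {f : E → F} (h : HasCbBound k c f) :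
    cbNorm k f ≤ (k + 1) * c := by
  refine (Finset.sum_le_card_nsmul _ _ c fun j hj =>
    supNorm_le (h.2 j (Nat.lt_succ_iff.1 (Finset.mem_range.1 hj)))).trans (le_of_eq ?_)
  simp

theorem IsCb.hasCbBound {k : ℕ} {f : E → F} (h : IsCb k f) : HasCbBound k (cbNorm k f) f :=
  ⟨h.1, fun _ hj => h.norm_iteratedFDeriv_le hj⟩

/-- The functional `θ ↦ ξ(θ e)` on scalar functions. -/
def component (ξ : Current E) (e : E) : Bdd E ℝ →L[ℝ] ℝ :=
  ξ.comp ((ContinuousLinearMap.toSpanSingleton ℝ e).compLeftContinuousBounded E)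

theorem isLipBounded_component (ξ : Current E) (e : E) :
    IsLipBounded (weakNorm ξ * (2 * ‖e‖)) (component ξ e) := by
  intro θ s h1 h2
  have h := abs_apply_le_weakNorm_mul ξ (s := s * ‖e‖) (L := s * ‖e‖₊)
    (θ := (ContinuousLinearMap.toSpanSingleton ℝ e).compLeftContinuousBounded E θ)
    ((BoundedContinuousFunction.norm_le (by positivity)).2 fun y => by
      rw [ContinuousLinearMap.compLeftContinuousBounded_apply,
        ContinuousLinearMap.toSpanSingleton_apply, norm_smul]
      exact mul_le_mul_of_nonneg_right (h1 y) (norm_nonneg e))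
    (LipschitzWith.of_dist_le_mul fun y y' => by
      rw [dist_eq_norm, dist_eq_norm, ContinuousLinearMap.compLeftContinuousBounded_apply,
        ContinuousLinearMap.compLeftContinuousBounded_apply,
        ContinuousLinearMap.toSpanSingleton_apply, ContinuousLinearMap.toSpanSingleton_apply,
        ← sub_smul, norm_smul, NNReal.coe_mul, coe_nnnorm, mul_right_comm]
      exact mul_le_mul_of_nonneg_right (h2.norm_sub_le y y') (norm_nonneg e))
  rw [NNReal.coe_mul, coe_nnnorm] at h
  exact h.trans (le_of_eq (by ring))

variable {d : ℕ} {K : Vec d → Matrix (Fin d) (Fin d) ℝ}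

/-- The entry `K_{ij}` as a bounded continuous function. -/
def entry (hK : IsKernel K) (i j : Fin d) : Bdd (Vec d) ℝ :=
  BoundedContinuousFunction.ofNormedAddCommGroup (fun x => K x i j) (hK.continuous_entry i j)
    (cbNorm 3 (fun x => K x i j)) (hK i j).1.norm_le

theorem rowField_eq_sum (hK : IsKernel K) (i : Fin d) (x : Vec d) :
    rowField K hK i x = ∑ j, (ContinuousLinearMap.toSpanSingleton ℝ
      (EuclideanSpace.single j (1 : ℝ))).compLeftContinuousBounded (Vec d)
        (translate (entry hK i j) x) := by
  ext y l
  rw [BoundedContinuousFunction.sum_apply]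
  simp [rowField, entry, Pi.single_apply]

theorem conv_eq_sum (hK : IsKernel K) (ξ : Current (Vec d)) :
    conv K hK ξ = fun x => ∑ i, ContinuousLinearMap.toSpanSingleton ℝ
      (EuclideanSpace.single i (1 : ℝ) : Vec d)
      (∑ j, component ξ (EuclideanSpace.single j 1) (translate (entry hK i j) x)) := by
  ext x l
  simp [conv, rowField_eq_sum, component, Pi.single_apply]

theorem exists_hasCbBound_conv (hK : IsKernel K) :
    ∃ c : ℝ, 0 ≤ c ∧ ∀ ξ, HasCbBound 2 (c * weakNorm ξ) (conv K hK ξ) := by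
  have hnonneg : ∀ i j, 0 ≤ cbNorm 3 (fun x => K x i j) := fun i j => cbNorm_nonneg _ _
  refine ⟨∑ i, ∑ j, ‖ContinuousLinearMap.toSpanSingleton ℝ
      (EuclideanSpace.single i (1 : ℝ) : Vec d)‖ * (2 *
        ‖(EuclideanSpace.single j (1 : ℝ) : Vec d)‖ * cbNorm 3 (fun x => K x i j)), ?_,
    fun ξ => ?_⟩
  · exact Finset.sum_nonneg fun i _ => Finset.sum_nonneg fun j _ =>
      mul_nonneg (norm_nonneg _) (mul_nonneg (by positivity) (hnonneg i j))
  · have key : HasCbBound 2 (∑ i, ‖ContinuousLinearMap.toSpanSingleton ℝ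
        (EuclideanSpace.single i (1 : ℝ) : Vec d)‖ * ∑ j, weakNorm ξ * (2 *
        ‖(EuclideanSpace.single j (1 : ℝ) : Vec d)‖) * cbNorm 3 (fun x => K x i j))
        (conv K hK ξ) := by
      rw [conv_eq_sum]
      exact HasCbBound.sum fun i _ => (HasCbBound.sum fun j _ =>
        (isLipBounded_component ξ (EuclideanSpace.single j (1 : ℝ))).hasCbBound_apply_translate
          (c := ⟨_, hnonneg i j⟩) (k := entry hK i j)
          (mul_nonneg (weakNorm_nonneg ξ) (by positivity)) (hK i j).1.hasCbBound).clm_comp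
        (ContinuousLinearMap.toSpanSingleton ℝ (EuclideanSpace.single i (1 : ℝ) : Vec d))
    convert key using 1
    rw [Finset.sum_mul]
    refine Finset.sum_congr rfl fun i _ => ?_
    rw [Finset.sum_mul, Finset.mul_sum]
    exact Finset.sum_congr rfl fun j _ => by ring

theorem conv_sub (hK : IsKernel K) (ξ η : Current (Vec d)) :
    conv K hK (ξ - η) = fun x => conv K hK ξ x - conv K hK η x := by
  ext x i
  simp [conv]

/-- The convolution is linear in the current, so all the estimates reduce to the bound of
`‖K ∗ ξ‖_{C_b^2}` by the weak norm of `ξ`. -/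
theorem exists_isDrift_conv (hK : IsKernel K) : ∃ C : ℝ, IsDrift C (conv K hK) := by
  obtain ⟨c, hc, h⟩ := exists_hasCbBound_conv hK
  have hdiff : ∀ ξ, Differentiable ℝ (conv K hK ξ) := fun ξ =>
    (h ξ).1.differentiable (by norm_num)
  have hle : ∀ ξ, cbNorm 2 (conv K hK ξ) ≤ 3 * c * weakNorm ξ := fun ξ =>
    (h ξ).cbNorm_le.trans (le_of_eq (by push_cast; ring))
  have hle' : ∀ ξ : Current (Vec d), c * weakNorm ξ ≤ 3 * c * weakNorm ξ := fun ξ => by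
    have := mul_nonneg hc (weakNorm_nonneg ξ)
    linarith
  refine ⟨3 * c, ⟨fun ξ => (h ξ).isCb, fun ξ ε hε => ?_, fun ξ => ?_, fun ξ η => ?_,
    fun ξ η => ?_⟩⟩
  · refine ⟨ε / (3 * c + 1), by positivity, fun ξ' hξ' => ?_⟩
    rw [← conv_sub]
    refine (hle _).trans_lt ?_
    rw [lt_div_iff₀ (by positivity)] at hξ'
    have := weakNorm_nonneg (ξ' - ξ)
    linarith
  · refine (hle ξ).trans ?_
    have := weakNorm_nonneg ξ
    nlinarith
  · rw [← conv_sub]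
    refine (supNorm_le fun x => ?_).trans (hle' (ξ - η))
    simpa using (h (ξ - η)).2 0 (by norm_num) x
  · refine (supNorm_le fun x => ?_).trans (hle' (ξ - η))
    rw [← fderiv_fun_sub (hdiff ξ x) (hdiff η x), ← conv_sub]
    simpa [norm_iteratedFDeriv_one] using (h (ξ - η)).2 1 (by norm_num) x

end Convolution

end CurrentFlow
end

theorem mainTheorem1 (d : ℕ) :
    (∀ C : ℝ, ∃ T : ℝ → ℝ, (∀ r, 0 < T r) ∧
      ∀ B : CurrentFlow.Current (CurrentFlow.Vec d) → CurrentFlow.Vec d → CurrentFlow.Vec d,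
        CurrentFlow.IsDrift C B →
        ∀ ξ₀ : CurrentFlow.Current (CurrentFlow.Vec d),
          ∃ ξ : ℝ → CurrentFlow.Current (CurrentFlow.Vec d),
            CurrentFlow.IsSolution B ξ₀ (T ‖ξ₀‖) ξ ∧
            ∀ ξ' : ℝ → CurrentFlow.Current (CurrentFlow.Vec d),
              CurrentFlow.IsSolution B ξ₀ (T ‖ξ₀‖) ξ' →
                Set.EqOn ξ' ξ (Set.Icc 0 (T ‖ξ₀‖))) ∧
    (∀ (K : CurrentFlow.Vec d → Matrix (Fin d) (Fin d) ℝ) (hK : CurrentFlow.IsKernel K),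
      ∃ C : ℝ, CurrentFlow.IsDrift C (CurrentFlow.conv K hK)) := by
  -- the absolute values make the time positive for all real `C` and `r`
  refine ⟨fun C => ⟨fun r => (2 * (|C| * (2 * |r| + 1)) + 1)⁻¹, fun r => by positivity,
    fun B hB ξ₀ => CurrentFlow.exists_unique_isSolution hB ξ₀ (by positivity) ?_⟩,
    fun K hK => CurrentFlow.exists_isDrift_conv hK⟩
  beta_reduce
  rw [abs_norm, abs_of_nonneg hB.const_nonneg, ← div_eq_mul_inv]
  have := hB.const_nonneg
  exact (div_le_one (by positivity)).2 (by linarith)
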